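/- Let $R$ be a commutative Noetherian ring and let $\Phi$ be a system of ideals of $R$, that is, a non-empty set of ideals such that for all $\mathfrak a_1,\mathfrak a_2\in\Phi$ there is $\mathfrak b\in\Phi$ with $\mathfrak b\subseteq\mathfrak a_1\mathfrak a_2$. For an $R$-module $M$ put $\Gamma_\Phi(M)=\{x\in M : \mathfrak a x=0 \text{ for some } \mathfrak a\in\Phi\}$, and let $H^i_\Phi$ denote the $i$-th right derived functor of the left exact functor $\Gamma_\Phi$ on the category of $R$-modules. Let $N$ be a $\Phi$-torsion $R$-module (that is, $\Gamma_\Phi(N)=N$), let $M$ be an arbitrary $R$-module, let $\mathcal S$ be a Serre subcategory of the category of $R$-modules (a class of modules containing $0$ and closed under submodules, quotients and extensions), and let $s,t\ge 0$ be integers such that (i) $\operatorname{Ext}^{s+t}_R(N,M)\in\mathcal S$; (ii) $\operatorname{Ext}^{s+1+i}_R(N,H^{t-i}_\Phi(M))\in\mathcal S$ for all $i$ with $1\le i\le t$; (iii) $\operatorname{Ext}^{s-1-i}_R(N,H^{t+i}_\Phi(M))\in\mathcal S$ for all $i$ with $1\le i\le s-1$. Then $\operatorname{Ext}^{s}_R(N,H^{t}_\Phi(M))\in\mathcal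 S$. -/

import Mathlib

open CategoryTheory

universe u

/-- A system of ideals of `R`: a non-empty set `Φ` of ideals such that the product of any two
members of `Φ` contains a member of `Φ`. -/
structure SystemOfIdeals (R : Type u) [CommRing R] where
  /-- The underlying set of ideals. -/
  carrier : Set (Ideal R)
  nonempty : carrier.Nonempty
  exists_le_mul : ∀ a ∈ carrier, ∀ b ∈ carrier, ∃ c ∈ carrier, c ≤ a * b

namespace SystemOfIdeals

variable {R : Type u} [CommRing R] (Φ : SystemOfIdeals R)

/-- The submodule `Γ_Φ(M) = {x ∈ M | a x = 0 for some a ∈ Φ}` of `M`. -/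
def torsion (M : Type u) [AddCommGroup M] [Module R M] : Submodule R M where
  carrier := {x | ∃ a ∈ Φ.carrier, ∀ r ∈ a, r • x = 0}
  zero_mem' := by
    obtain ⟨a, ha⟩ := Φ.nonempty
    exact ⟨a, ha, fun r _ => smul_zero r⟩
  add_mem' := by
    rintro x y ⟨a, ha, hx⟩ ⟨b, hb, hy⟩
    obtain ⟨c, hc, hle⟩ := Φ.exists_le_mul a ha b hb
    refine ⟨c, hc, fun r hr => ?_⟩
    have hra : r ∈ a := (hle.trans Ideal.mul_le_left) hr
    have hrb : r ∈ b := (hle.trans Ideal.mul_le_right) hr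
    rw [smul_add, hx r hra, hy r hrb, add_zero]
  smul_mem' := by
    rintro s x ⟨a, ha, hx⟩
    exact ⟨a, ha, fun r hr => by rw [smul_comm, hx r hr, smul_zero]⟩

/-- A module `N` is `Φ`-torsion if `Γ_Φ(N) = N`. -/
def IsTorsion (N : Type u) [AddCommGroup N] [Module R N] : Prop :=
  Φ.torsion N = ⊤

lemma map_mem_torsion {M N : Type u} [AddCommGroup M] [Module R M] [AddCommGroup N] [Module R N]
    (f : M →ₗ[R] N) : ∀ x ∈ Φ.torsion M, f x ∈ Φ.torsion N := by
  rintro x ⟨a, ha, hx⟩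
  exact ⟨a, ha, fun r hr => by rw [← map_smul, hx r hr, map_zero]⟩

/-- The functor `Γ_Φ` from `R`-modules to `R`-modules; on morphisms it is restriction. -/
def torsionFunctor : ModuleCat.{u} R ⥤ ModuleCat.{u} R where
  obj M := ModuleCat.of R (Φ.torsion M)
  map f := ModuleCat.ofHom (f.hom.restrict (Φ.map_mem_torsion f.hom))
  map_id _ := rfl
  map_comp _ _ := rfl

instance : Φ.torsionFunctor.Additive where
  map_add := rfl

/-- The general local cohomology functor `H^i_Φ`, the `i`-th right derived functor of `Γ_Φ`. -/
noncomputable def localCohomology (i : ℕ) : ModuleCat.{u} R ⥤ ModuleCat.{u} R :=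
  Φ.torsionFunctor.rightDerived i

end SystemOfIdeals

/-- The `R`-module `Ext^n_R(N, M)`. -/
noncomputable def extModule {R : Type u} [CommRing R] (n : ℕ) (N M : ModuleCat.{u} R) :
    ModuleCat.{u} R :=
  ModuleCat.of R (Abelian.Ext.{u} N M n)

open Limits Abelian

open scoped ZeroObject

universe w

/-!
Over a Noetherian ring, `Γ_Φ` preserves injectives by the Artin–Rees lemma. Hence, if `E` is
injective, `E / Γ_Φ(E)` is a direct summand of `E`, and `Ext^p(N, E / Γ_Φ(E)) = 0` for all `p` as
soon as every morphism `N ⟶ E` factors through `Γ_Φ(E)`, which holds for `N` torsion. For an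
injective resolution `I` of `M`, the complex `A` given by `M ⟶ I⁰ / Γ_Φ(I⁰) ⟶ I¹ / Γ_Φ(I¹) ⟶ ⋯`
therefore has `H^n(A) = H^n_Φ(M)`, and only the term `A⁰ = M` contributes to `Ext(N, -)`. So
dimension shifting along the sequences `0 ⟶ H^n(A) ⟶ coker d^{n-1} ⟶ im d^n ⟶ 0` and
`0 ⟶ im d^n ⟶ A^{n+1} ⟶ coker d^n ⟶ 0` takes the place of the Grothendieck spectral sequence.
-/

namespace SystemOfIdeals

variable {R : Type u} [CommRing R] (Φ : SystemOfIdeals R)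

lemma exists_le_pow {a : Ideal R} (ha : a ∈ Φ.carrier) (n : ℕ) : ∃ b ∈ Φ.carrier, b ≤ a ^ n := by
  induction n with
  | zero => exact ⟨a, ha, by simp⟩
  | succ n ih =>
    obtain ⟨c, hc, hca⟩ := ih
    obtain ⟨b, hb, hbc⟩ := Φ.exists_le_mul c hc a ha
    exact ⟨b, hb, hbc.trans (pow_succ a n ▸ Ideal.mul_mono_left hca)⟩

lemma exists_le_annihilator_of_fg {M : Type u} [AddCommGroup M] [Module R M] {p : Submodule R M}
    (hp : p.FG) (hpt : p ≤ Φ.torsion M) : ∃ a ∈ Φ.carrier, a ≤ p.annihilator := by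
  induction p, hp using Submodule.fg_induction with
  | singleton x =>
    obtain ⟨a, ha, hax⟩ := hpt (Submodule.mem_span_singleton_self x)
    exact ⟨a, ha, fun r hr => (Submodule.mem_annihilator_span_singleton x r).2 (hax r hr)⟩
  | sup p q _ _ ihp ihq =>
    obtain ⟨a, ha, hap⟩ := ihp (le_sup_left.trans hpt)
    obtain ⟨b, hb, hbq⟩ := ihq (le_sup_right.trans hpt)
    obtain ⟨c, hc, hcab⟩ := Φ.exists_le_mul a ha b hb
    refine ⟨c, hc, ?_⟩
    rw [Submodule.annihilator_sup]
    exact hcab.trans (Ideal.mul_le_inf.trans (inf_le_inf hap hbq))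

lemma exists_smul_top_inf_le_map_ker [IsNoetherianRing R] {M : Type*} {E : Type u}
    [AddCommGroup M] [Module R M] [Module.Finite R M] [AddCommGroup E] [Module R E]
    (p : Submodule R M) (f : p →ₗ[R] E) (hf : LinearMap.range f ≤ Φ.torsion E) :
    ∃ b ∈ Φ.carrier, b • ⊤ ⊓ p ≤ (LinearMap.ker f).map p.subtype := by
  obtain ⟨a, ha, haf⟩ := Φ.exists_le_annihilator_of_fg
    (Module.Finite.iff_fg.1 (Module.Finite.range f)) hf
  have smul_le_ker : a • p ≤ (LinearMap.ker f).map p.subtype :=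
    Submodule.smul_le.2 fun r hr y hy => ⟨r • ⟨y, hy⟩, (map_smul f r _).trans
      (Submodule.mem_annihilator.1 (haf hr) _ (LinearMap.mem_range_self f ⟨y, hy⟩)), rfl⟩
  obtain ⟨k, hk⟩ := a.exists_pow_inf_eq_pow_smul p
  obtain ⟨b, hb, hba⟩ := Φ.exists_le_pow ha (k + 1)
  refine ⟨b, hb, ?_⟩
  calc b • ⊤ ⊓ p ≤ a ^ (k + 1) • ⊤ ⊓ p := inf_le_inf_right p (Submodule.smul_mono_left hba)
    _ = a • (a ^ k • ⊤ ⊓ p) := by rw [hk (k + 1) k.le_succ, Nat.add_sub_cancel_left, pow_one]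
    _ ≤ a • p := Submodule.smul_mono le_rfl inf_le_right
    _ ≤ (LinearMap.ker f).map p.subtype := smul_le_ker

end SystemOfIdeals

lemma exists_extend_of_inf_le_map_ker {R : Type*} [Ring R] {M E : Type u} [AddCommGroup M]
    [Module R M] [AddCommGroup E] [Module R E] [Module.Injective R E] {p q : Submodule R M}
    (f : p →ₗ[R] E) (hf : q ⊓ p ≤ (LinearMap.ker f).map p.subtype) :
    ∃ g : M →ₗ[R] E, g ∘ₗ p.subtype = f ∧ q ≤ LinearMap.ker g := by
  let fp : M →ₗ.[R] E := ⟨p, f⟩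
  let zq : M →ₗ.[R] E := ⟨q, 0⟩
  have agree : ∀ (x : fp.domain) (y : zq.domain), (x : M) = y → fp x = zq y := by
    intro x y hxy
    obtain ⟨z, hz, hzx⟩ := hf ⟨hxy ▸ y.2, x.2⟩
    obtain rfl : z = x := Subtype.ext hzx
    exact hz
  obtain ⟨g, hg⟩ := Module.Injective.out (fp.sup zq agree).domain.subtype
    (Submodule.subtype_injective _) (fp.sup zq agree).toFun
  refine ⟨g, LinearMap.ext fun x => ?_, fun y hy => ?_⟩
  · exact (hg ⟨x, Submodule.mem_sup_left x.2⟩).trans ((fp.left_le_sup zq agree).2 rfl).symm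
  · exact (hg ⟨y, Submodule.mem_sup_right hy⟩).trans
      ((fp.right_le_sup zq agree).2 (x := ⟨y, hy⟩) rfl).symm

namespace SystemOfIdeals

variable {R : Type u} [CommRing R] (Φ : SystemOfIdeals R)

theorem injective_torsion [IsNoetherianRing R] (E : Type u) [AddCommGroup E] [Module R E]
    [Module.Injective R E] : Module.Injective R (Φ.torsion E) := by
  refine Module.Baer.injective fun I f => ?_
  obtain ⟨b, hb, hbf⟩ := Φ.exists_smul_top_inf_le_map_ker I ((Φ.torsion E).subtype ∘ₗ f)
    (by rintro _ ⟨x, rfl⟩; exact (f x).2)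
  obtain ⟨g, hgf, hbg⟩ := exists_extend_of_inf_le_map_ker _ hbf
  have g_mem_torsion (x : R) : g x ∈ Φ.torsion E := ⟨b, hb, fun r hr => by
    rw [← map_smul]; exact hbg (Submodule.smul_mem_smul hr Submodule.mem_top)⟩
  exact ⟨g.codRestrict _ g_mem_torsion,
    fun x hx => Subtype.ext (LinearMap.congr_fun hgf ⟨x, hx⟩)⟩

instance [IsNoetherianRing R] : Φ.torsionFunctor.PreservesInjectiveObjects where
  injective_obj {E} _ :=
    have : Module.Injective R E := Module.injective_module_of_injective_object R E
    have := Φ.injective_torsion E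
    Module.injective_object_of_injective_module R (Φ.torsion E)

/-- The inclusion of functors `Γ_Φ ⟶ 𝟭`. -/
def torsionι : Φ.torsionFunctor ⟶ 𝟭 (ModuleCat.{u} R) where
  app M := ModuleCat.ofHom (Φ.torsion M).subtype

instance (M : ModuleCat.{u} R) : Mono (Φ.torsionι.app M) :=
  (ModuleCat.mono_iff_injective _).2 Subtype.val_injective

instance : Mono Φ.torsionι := NatTrans.mono_of_mono_app _

/-- The functor `Γ_Φ` as a preradical on the category of `R`-modules. -/
def preradical : Preradical (ModuleCat.{u} R) := MonoOver.mk Φ.torsionι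

instance [IsNoetherianRing R] : Φ.preradical.r.PreservesInjectiveObjects :=
  inferInstanceAs Φ.torsionFunctor.PreservesInjectiveObjects

variable {Φ} in
lemma IsTorsion.isIso_preradical_ι_app {N : ModuleCat.{u} R} (hN : Φ.IsTorsion N) :
    IsIso (Φ.preradical.ι.app N) :=
  (ConcreteCategory.isIso_iff_bijective (Φ.torsionι.app N)).2
    ⟨Subtype.val_injective, fun x => ⟨⟨x, hN ▸ Submodule.mem_top⟩, rfl⟩⟩

end SystemOfIdeals

section Ext

variable {R : Type*} [CommRing R] {C : Type*} [Category* C] [Abelian C] [Linear R C] [HasExt.{w} C]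
  (S : ObjectProperty (ModuleCat.{w} R)) [S.IsSerreClass] (N : C)

/-- The class of objects `X` such that `Ext^n(N, X)` belongs to `S`. -/
def extProperty (n : ℕ) : ObjectProperty C := fun X => S (ModuleCat.of R (Ext.{w} N X n))

variable {S N}

lemma extProperty_of_subsingleton {X : C} {n : ℕ} [Subsingleton (Ext.{w} N X n)] :
    extProperty S N n X :=
  S.prop_of_isZero (ModuleCat.isZero_of_subsingleton (ModuleCat.of R (Ext.{w} N X n)))

lemma extProperty_zero_of_mono {X Y : C} (f : X ⟶ Y) [Mono f] (hY : extProperty S N 0 Y) :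
    extProperty S N 0 X := by
  let postcomp := ModuleCat.ofHom ((Ext.mk₀ f).postcompOfLinear R N (add_zero 0))
  have : Mono postcomp :=
    (ModuleCat.mono_iff_injective _).2 (Ext.postcomp_mk₀_injective_of_mono N f)
  exact S.prop_of_mono postcomp hY

instance (n : ℕ) : (extProperty S N n).IsClosedUnderIsomorphisms where
  of_iso e hA := by
    refine S.prop_of_iso (LinearEquiv.toModuleIso (LinearEquiv.ofLinearMap
      ((Ext.mk₀ e.hom).postcompOfLinear R N (add_zero n))
      ((Ext.mk₀ e.inv).postcompOfLinear R N (add_zero n)) ?_ ?_)) hA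
    all_goals ext x; simp

lemma prop_of_function_exact {A B D : Type w} [AddCommGroup A] [AddCommGroup B] [AddCommGroup D]
    [Module R A] [Module R B] [Module R D] {f : A →ₗ[R] B} {g : B →ₗ[R] D}
    (h : Function.Exact f g) (hA : S (ModuleCat.of R A)) (hD : S (ModuleCat.of R D)) :
    S (ModuleCat.of R B) :=
  S.prop_X₂_of_exact (S := .mk (ModuleCat.ofHom f) (ModuleCat.ofHom g)
    (by ext x; exact h.apply_apply_eq_zero x))
    ((ShortComplex.ShortExact.moduleCat_exact_iff_function_exact _).2 h) hA hD

variable {X : ShortComplex C} (hX : X.ShortExact) {n : ℕ}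

include hX

lemma extProperty_X₂ (h₁ : extProperty S N n X.X₁) (h₃ : extProperty S N n X.X₃) :
    extProperty S N n X.X₂ :=
  prop_of_function_exact (f := (Ext.mk₀ X.f).postcompOfLinear R N (add_zero n))
    (g := (Ext.mk₀ X.g).postcompOfLinear R N (add_zero n))
    (fun x => ⟨Ext.covariant_sequence_exact₂ N hX x, by rintro ⟨y, rfl⟩; simp⟩) h₁ h₃

lemma extProperty_X₃ (h₂ : extProperty S N n X.X₂) (h₁ : extProperty S N (n + 1) X.X₁) :
    extProperty S N n X.X₃ :=
  prop_of_function_exact (f := (Ext.mk₀ X.g).postcompOfLinear R N (add_zero n))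
    (g := hX.extClass.postcompOfLinear R N rfl)
    (fun x => ⟨Ext.covariant_sequence_exact₃ N hX x rfl, by rintro ⟨y, rfl⟩; simp⟩) h₂ h₁

lemma extProperty_X₁ (h₃ : extProperty S N n X.X₃) (h₂ : extProperty S N (n + 1) X.X₂) :
    extProperty S N (n + 1) X.X₁ :=
  prop_of_function_exact (f := hX.extClass.postcompOfLinear R N rfl)
    (g := (Ext.mk₀ X.f).postcompOfLinear R N (add_zero (n + 1)))
    (fun x => ⟨fun hx => Ext.covariant_sequence_exact₁ N hX x hx rfl,
      by rintro ⟨y, rfl⟩; simp⟩) h₃ h₂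

end Ext

section Opcycles

variable {C ι : Type*} [Category* C] [Abelian C] {c : ComplexShape ι} (K : HomologicalComplex C c)
  (i j : ι)

/-- The sequence `0 ⟶ H^i(K) ⟶ K^i / im d ⟶ im d ⟶ 0`, where the last map is induced by the
differential from degree `i` to degree `j`. -/
noncomputable def homologyOpcyclesSequence : ShortComplex C :=
  .mk (K.homologyι i) (Abelian.factorThruImage (K.fromOpcycles i j))
    (by rw [← cancel_mono (Abelian.image.ι _)]; simp)

/-- The sequence `0 ⟶ im d ⟶ K^j ⟶ K^j / im d ⟶ 0`, where `d` is the differential from degree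
`i` to degree `j`. -/
noncomputable def coboundariesOpcyclesSequence : ShortComplex C :=
  .mk (Abelian.image.ι (K.fromOpcycles i j)) (K.pOpcycles j)
    (by rw [← cancel_epi (Abelian.factorThruImage _), ← cancel_epi (K.pOpcycles i)]; simp)

variable {i j}

lemma shortExact_homologyOpcyclesSequence (hij : c.next i = j) :
    (homologyOpcyclesSequence K i j).ShortExact where
  exact := ShortComplex.exact_of_f_is_kernel _
    (isKernelOfComp (Abelian.image.ι _) _ (K.homologyIsKernel i j hij)
      (homologyOpcyclesSequence K i j).zero (Abelian.image.fac _))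
  mono_f := inferInstanceAs (Mono (K.homologyι i))
  epi_g := inferInstanceAs (Epi (Abelian.factorThruImage (K.fromOpcycles i j)))

lemma shortExact_coboundariesOpcyclesSequence (hij : c.prev j = i) :
    (coboundariesOpcyclesSequence K i j).ShortExact where
  exact := ShortComplex.exact_of_g_is_cokernel _
    (isCokernelOfComp (K.pOpcycles i ≫ Abelian.factorThruImage _) _ (K.opcyclesIsCokernel i j hij)
      (coboundariesOpcyclesSequence K i j).zero
      (by simp [coboundariesOpcyclesSequence]))
  mono_f := inferInstanceAs (Mono (Abelian.image.ι (K.fromOpcycles i j)))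
  epi_g := inferInstanceAs (Epi (K.pOpcycles j))

end Opcycles

section ExtOfComplex

variable {R : Type*} [CommRing R] {C : Type*} [Category* C] [Abelian C] [Linear R C] [HasExt.{w} C]
  {S : ObjectProperty (ModuleCat.{w} R)} [S.IsSerreClass] {N : C} {A : CochainComplex C ℕ}
  (hA : ∀ n p, Subsingleton (Ext.{w} N (A.X (n + 1)) p))

include hA

lemma extProperty_zero_coboundaries (n : ℕ) :
    extProperty S N 0 (Abelian.image (A.fromOpcycles n (n + 1))) :=
  have := hA n 0
  extProperty_zero_of_mono (Abelian.image.ι _) extProperty_of_subsingleton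

lemma extProperty_succ_coboundaries_iff (p n : ℕ) :
    extProperty S N (p + 1) (Abelian.image (A.fromOpcycles n (n + 1))) ↔
      extProperty S N p (A.opcycles (n + 1)) := by
  have hB := shortExact_coboundariesOpcyclesSequence A (i := n) (j := n + 1) (by simp)
  have := hA n
  exact ⟨extProperty_X₃ hB (extProperty_of_subsingleton (X := A.X (n + 1))),
    fun h => extProperty_X₁ hB h (extProperty_of_subsingleton (X := A.X (n + 1)))⟩

lemma extProperty_opcycles_of_homology_ge (p n : ℕ)
    (h : ∀ i j, i + j = p + n → n ≤ j → extProperty S N i (A.homology j)) :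
    extProperty S N p (A.opcycles n) := by
  have hH n := shortExact_homologyOpcyclesSequence A (i := n) (j := n + 1) (by simp)
  induction p generalizing n with
  | zero => exact extProperty_X₂ (hH n) (h 0 n rfl le_rfl) (extProperty_zero_coboundaries hA n)
  | succ p ih =>
    refine extProperty_X₂ (hH n) (h (p + 1) n rfl le_rfl)
      ((extProperty_succ_coboundaries_iff hA p n).2 (ih (n + 1) fun i j hij hj => ?_))
    exact h i j (by lia) (by lia)

lemma extProperty_opcycles_of_homology_lt (s t : ℕ)
    (h₀ : extProperty S N (s + t) (A.opcycles 0))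
    (h : ∀ p q, p + q = s + t + 1 → q < t → extProperty S N p (A.homology q)) :
    extProperty S N s (A.opcycles t) := by
  induction t generalizing s with
  | zero => exact h₀
  | succ t ih =>
    have hH := shortExact_homologyOpcyclesSequence A (i := t) (j := t + 1) (by simp)
    refine (extProperty_succ_coboundaries_iff hA s t).1
      (extProperty_X₃ hH (ih (s + 1) ?_ fun p q hpq hq => ?_) ?_)
    · rwa [Nat.add_right_comm]
    · exact h p q (by lia) (by lia)
    · exact h (s + 1 + 1) t (by lia) (by lia)

theorem extProperty_homology (s t : ℕ) (h₁ : extProperty S N (s + t) (A.opcycles 0))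
    (h₂ : ∀ p q, p + q = s + t + 1 → q < t → extProperty S N p (A.homology q))
    (h₃ : ∀ p q, p + q + 1 = s + t → t < q → extProperty S N p (A.homology q)) :
    extProperty S N s (A.homology t) := by
  have hH := shortExact_homologyOpcyclesSequence A (i := t) (j := t + 1) (by simp)
  have hZ := extProperty_opcycles_of_homology_lt hA s t h₁ h₂
  match s with
  | 0 => exact extProperty_zero_of_mono (A.homologyι t) hZ
  | 1 => exact extProperty_X₁ hH (extProperty_zero_coboundaries hA t) hZ
  | s + 2 =>
    refine extProperty_X₁ hH ((extProperty_succ_coboundaries_iff hA s t).2 ?_) hZ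
    exact extProperty_opcycles_of_homology_ge hA s (t + 1) fun p q hpq hq =>
      h₃ p q (by lia) hq

end ExtOfComplex

section Augment

variable {C : Type*} [Category* C] [Abelian C] {K L : CochainComplex C ℕ} {X Y : C}
  {f : X ⟶ K.X 0} {g : Y ⟶ L.X 0} {hf : f ≫ K.d 0 1 = 0} {hg : g ≫ L.d 0 1 = 0}

/-- The morphism of augmented cochain complexes given by a morphism of complexes and a compatible
morphism between the augmenting objects. -/
def augmentMap (φ : K ⟶ L) (ψ : X ⟶ Y) (h : f ≫ φ.f 0 = ψ ≫ g) :
    K.augment f hf ⟶ L.augment g hg where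
  f
    | 0 => ψ
    | n + 1 => φ.f n
  comm' := by
    rintro (_ | i) _ rfl
    · exact h.symm
    · exact φ.comm i (i + 1)

lemma mono_augmentMap (φ : K ⟶ L) (ψ : X ⟶ Y) (h : f ≫ φ.f 0 = ψ ≫ g) (hφ : ∀ n, Mono (φ.f n))
    [Mono ψ] : Mono (augmentMap (hf := hf) (hg := hg) φ ψ h) :=
  HomologicalComplex.mono_of_mono_f _ fun
    | 0 => inferInstanceAs (Mono ψ)
    | n + 1 => hφ n

/-- Augmenting by a zero object shifts the homology by one. -/
noncomputable def augmentHomologyIso (hX : IsZero X) (n : ℕ) :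
    (K.augment f hf).homology (n + 1) ≅ K.homology n :=
  (K.augment f hf).homologyIsoSc' n (n + 1) (n + 2) (by simp) (by simp) ≪≫
    match n with
    | 0 =>
      let φ : K.sc' 0 0 1 ⟶ (K.augment f hf).sc' 0 1 2 :=
        { τ₁ := 0
          τ₂ := 𝟙 (K.X 0)
          τ₃ := 𝟙 (K.X 1)
          comm₁₂ := zero_comp.trans ((Category.comp_id _).trans (K.shape 0 0 (by simp))).symm
          comm₂₃ := (Category.id_comp _).trans (Category.comp_id _).symm }
      have : Epi φ.τ₁ := hX.epi _
      have : IsIso φ.τ₂ := inferInstanceAs (IsIso (𝟙 (K.X 0)))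
      have : Mono φ.τ₃ := inferInstanceAs (Mono (𝟙 (K.X 1)))
      have : IsIso (ShortComplex.homologyMap φ) :=
        ShortComplex.isIso_homologyMap_of_epi_of_isIso_of_mono φ
      (asIso (ShortComplex.homologyMap φ)).symm ≪≫
        (K.homologyIsoSc' 0 0 1 (by simp) (by simp)).symm
    | n + 1 => (K.homologyIsoSc' n (n + 1) (n + 2) (by simp) (by simp)).symm

variable {M : C} (I : InjectiveResolution M)

/-- The complex `0 ⟶ M ⟶ I⁰ ⟶ I¹ ⟶ ⋯`, with `M` in degree `0`. -/
noncomputable def augmentedResolution : CochainComplex C ℕ :=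
  I.cocomplex.augment (X := M) (I.ι.f 0) I.ι_f_zero_comp_complex_d

lemma acyclic_augmentedResolution : (augmentedResolution I).Acyclic
  | 0 => by
    rw [HomologicalComplex.exactAt_iff' _ 0 0 1 (by simp) (by simp)]
    exact (ShortComplex.exact_iff_mono _ rfl).2 (inferInstanceAs (Mono (I.ι.f 0)))
  | 1 => by
    rw [HomologicalComplex.exactAt_iff' _ 0 1 2 (by simp) (by simp)]
    exact ShortComplex.exact_of_f_is_kernel _ I.isLimitKernelFork
  | n + 2 => by
    rw [HomologicalComplex.exactAt_iff' _ (n + 1) (n + 2) (n + 3) (by simp) (by simp)]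
    exact I.exact_succ n

end Augment

lemma subsingleton_ext_X₃_of_injective {C : Type*} [Category* C] [Abelian C] [HasExt.{w} C] {N : C}
    {X : ShortComplex C} (hX : X.ShortExact) [Injective X.X₁] [Injective X.X₂]
    (hN : ∀ f : N ⟶ X.X₂, ∃ g : N ⟶ X.X₁, g ≫ X.f = f) (n : ℕ) :
    Subsingleton (Ext.{w} N X.X₃ n) := by
  refine subsingleton_of_forall_eq 0 fun x => ?_
  obtain ⟨y, rfl⟩ := Ext.covariant_sequence_exact₃ N hX x rfl (Ext.eq_zero_of_injective _)
  cases n with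
  | zero =>
    obtain ⟨f, rfl⟩ := Ext.addEquiv₀.symm.surjective y
    obtain ⟨g, rfl⟩ := hN f
    simp
  | succ n => rw [Ext.eq_zero_of_injective y, Ext.zero_comp]

section Preradical

variable {C : Type*} [Category* C] [Abelian C] (T : Preradical C)

instance : T.r.Additive where
  map_add {X Y f g} := by
    rw [← cancel_mono (T.ι.app Y)]
    simp [Preadditive.add_comp]

variable {M : C} (I : InjectiveResolution M)

/-- The complex `0 ⟶ T I⁰ ⟶ T I¹ ⟶ ⋯`, with the zero object in degree `0`. -/
noncomputable def preradicalComplex : CochainComplex C ℕ :=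
  CochainComplex.augment ((T.r.mapHomologicalComplex _).obj I.cocomplex) (0 : (0 : C) ⟶ _)
    zero_comp

/-- The inclusion of `0 ⟶ T I⁰ ⟶ T I¹ ⟶ ⋯` into `M ⟶ I⁰ ⟶ I¹ ⟶ ⋯`. -/
noncomputable def preradicalComplexι : preradicalComplex T I ⟶ augmentedResolution I :=
  augmentMap (K := (T.r.mapHomologicalComplex _).obj I.cocomplex)
    { f n := T.ι.app (I.cocomplex.X n)
      comm' i j _ := (T.ι.naturality (I.cocomplex.d i j)).symm }
    (0 : (0 : C) ⟶ M) (zero_comp.trans zero_comp.symm)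

instance : Mono (preradicalComplexι T I) :=
  have : Mono (0 : (0 : C) ⟶ M) := (isZero_zero C).mono _
  mono_augmentMap _ _ _ fun n => inferInstanceAs (Mono (T.ι.app (I.cocomplex.X n)))

/-- The short exact sequence of complexes whose last term is the quotient complex
`M ⟶ I⁰ / T I⁰ ⟶ I¹ / T I¹ ⟶ ⋯`. -/
noncomputable def preradicalSequence : ShortComplex (CochainComplex C ℕ) :=
  .mk (preradicalComplexι T I) (cokernel.π _) (cokernel.condition _)

lemma shortExact_preradicalSequence : (preradicalSequence T I).ShortExact where
  exact := ShortComplex.exact_cokernel _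
  mono_f := inferInstanceAs (Mono (preradicalComplexι T I))
  epi_g := inferInstanceAs (Epi (cokernel.π (preradicalComplexι T I)))

lemma shortExact_preradicalSequence_eval (n : ℕ) :
    ((preradicalSequence T I).map (HomologicalComplex.eval C _ n)).ShortExact :=
  (HomologicalComplex.shortExact_iff_degreewise_shortExact _).1
    (shortExact_preradicalSequence T I) n

/-- In degree `0` the quotient complex `M ⟶ I⁰ / T I⁰ ⟶ ⋯` is `M`. -/
noncomputable def preradicalOpcyclesIso : M ≅ (preradicalSequence T I).X₃.opcycles 0 :=
  let π : M ⟶ (preradicalSequence T I).X₃.X 0 := (preradicalSequence T I).g.f 0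
  have : IsIso π := (shortExact_preradicalSequence_eval T I 0).isIso_g_iff.2 (isZero_zero C)
  asIso π ≪≫ (preradicalSequence T I).X₃.opcycles₀Iso

/-- The cohomology of the quotient complex `M ⟶ I⁰ / T I⁰ ⟶ ⋯` is that of `T`, since
`M ⟶ I⁰ ⟶ I¹ ⟶ ⋯` is acyclic. -/
noncomputable def preradicalHomologyIso [HasInjectiveResolutions C] (n : ℕ) :
    (preradicalSequence T I).X₃.homology n ≅ (T.r.rightDerived n).obj M :=
  have acyclic (i : ℕ) : IsZero ((preradicalSequence T I).X₂.homology i) :=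
    (acyclic_augmentedResolution I i).isZero_homology
  (shortExact_preradicalSequence T I).δIso n (n + 1) rfl (acyclic _) (acyclic _) ≪≫
    augmentHomologyIso (hf := zero_comp) (isZero_zero C) n ≪≫ (I.isoRightDerivedObj T.r n).symm

lemma subsingleton_ext_preradicalSequence_X₃ [HasExt.{w} C] [T.r.PreservesInjectiveObjects] (N : C)
    [IsIso (T.ι.app N)] (n p : ℕ) :
    Subsingleton (Ext.{w} N ((preradicalSequence T I).X₃.X (n + 1)) p) := by
  let X := (preradicalSequence T I).map (HomologicalComplex.eval C _ (n + 1))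
  have : Injective X.X₁ := T.r.injective_obj (I.cocomplex.X n)
  have : Injective X.X₂ := inferInstanceAs (Injective (I.cocomplex.X n))
  have factors (f : N ⟶ I.cocomplex.X n) :
      (inv (T.ι.app N) ≫ T.r.map f) ≫ T.ι.app (I.cocomplex.X n) = f := by simp
  exact subsingleton_ext_X₃_of_injective (shortExact_preradicalSequence_eval T I (n + 1))
    (fun f => ⟨_, factors f⟩) p

end Preradical

theorem theorem2p8_general {R : Type*} [CommRing R] {C : Type*} [Category* C] [Abelian C]
    [Linear R C] [HasExt.{w} C] [HasInjectiveResolutions C] (T : Preradical C)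
    [T.r.PreservesInjectiveObjects] (S : ObjectProperty (ModuleCat.{w} R)) [S.IsSerreClass]
    (N M : C) [IsIso (T.ι.app N)] (s t : ℕ)
    (h₁ : extProperty S N (s + t) M)
    (h₂ : ∀ i : ℕ, 1 ≤ i → i ≤ t →
      extProperty S N (s + 1 + i) ((T.r.rightDerived (t - i)).obj M))
    (h₃ : ∀ i : ℕ, 1 ≤ i → i + 1 ≤ s →
      extProperty S N (s - 1 - i) ((T.r.rightDerived (t + i)).obj M)) :
    extProperty S N s ((T.r.rightDerived t).obj M) := by
  let I := injectiveResolution M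
  let homologyIso := preradicalHomologyIso T I
  refine ObjectProperty.prop_of_iso _ (homologyIso t) (extProperty_homology
    (subsingleton_ext_preradicalSequence_X₃ T I N) s t
    (ObjectProperty.prop_of_iso _ (preradicalOpcyclesIso T I) h₁)
    (fun p q hpq hq => ObjectProperty.prop_of_iso _ (homologyIso q).symm ?_)
    (fun p q hpq hq => ObjectProperty.prop_of_iso _ (homologyIso q).symm ?_))
  · obtain rfl : p = s + 1 + (t - q) := by lia
    simpa only [Nat.sub_sub_self hq.le] using h₂ (t - q) (by lia) (by lia)
  · obtain rfl : p = s - 1 - (q - t) := by lia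
    simpa only [Nat.add_sub_cancel' hq.le] using h₃ (q - t) (by lia) (by lia)

theorem theorem2p8 {R : Type u} [CommRing R] [IsNoetherianRing R] (Φ : SystemOfIdeals R)
    (S : ObjectProperty (ModuleCat.{u} R)) [S.IsSerreClass]
    (N M : ModuleCat.{u} R) (hN : Φ.IsTorsion N) (s t : ℕ)
    (h₁ : S (extModule (s + t) N M))
    (h₂ : ∀ i : ℕ, 1 ≤ i → i ≤ t →
      S (extModule (s + 1 + i) N ((Φ.localCohomology (t - i)).obj M)))
    (h₃ : ∀ i : ℕ, 1 ≤ i → i + 1 ≤ s →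
      S (extModule (s - 1 - i) N ((Φ.localCohomology (t + i)).obj M))) :
    S (extModule s N ((Φ.localCohomology t).obj M)) :=
  have := hN.isIso_preradical_ι_app
  theorem2p8_general Φ.preradical S N M s t h₁ h₂ h₃
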